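/- Let $\mu$ be a nontrivial (i.e. with infinite support) finite positive Borel measure on the unit circle $\mathbb{T}$. Let $\Phi_n$ be its monic orthogonal polynomials ($\int_{\mathbb T} \Phi_n\overline{\Phi_m}\,d\mu=0$ for $n\ne m$), $\kappa_n=\|\Phi_n\|_{L^2(\mu)}^{-1}$, $\varphi_n=\kappa_n\Phi_n$, $\Phi_n^*(z)=z^n\overline{\Phi_n(1/\bar z)}$, $\alpha_n=-\overline{\Phi_{n+1}(0)}$ the Verblunsky coefficients, and $\tau_n=\Phi_n(1)/\Phi_n^*(1)$. Let $K_n(1,z)=\sum_{j=0}^n\overline{\varphi_j(1)}\,\varphi_j(z)$ be the Christoffel--Darboux kernel, let $$P_n(1;z)=\frac{\kappa_{n+1}^{-2}}{\overline{\Phi_{n+1}(1)}}\,\frac{K_n(1,z)}{1+\tau_{n+1}\alpha_n}$$ be its monic normalization, and put $R_0(z)=1$ and $$R_n(z)=\Big(\prod_{j=1}^n\frac{1-\tau_{j-1}\alpha_{j-1}}{1-\operatorname{Re}(\tau_{j-1}\alpha_{j-1})}\Big)P_n(1;z),\qquad n\ge 1.$$ For $x\in[-1,1]$ put $\mathcal{W}_n(x)=2^{-n}e^{-in\theta/2}R_n(e^{i\theta})$,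 where $x=\cos(\theta/2)$, $\theta\in[0,2\pi]$. Write $\mathcal{A}(a,b)=\{e^{i\theta}:a<\theta<b\}$ and $\mathcal{A}[a,b]=\{e^{i\theta}:a\le\theta\le b\}$. Assume $0<\vartheta_1<\vartheta_2<2\pi$. Then for every $n\ge 0$: a) If $\operatorname{supp}\mu\cap\mathcal{A}(0,\vartheta_1)=\emptyset$, then $\mathcal{W}_n$ has no zeros in $[\cos(\vartheta_1/2),1]$ and, equivalently, $R_n$ does not vanish on $\mathcal{A}[0,\vartheta_1]$. b) If $\operatorname{supp}\mu\cap\mathcal{A}(\vartheta_2,2\pi)=\emptyset$, then $\mathcal{W}_n$ has no zeros in $[-1,\cos(\vartheta_2/2)]$ and, equivalently, $R_n$ does not vanish on $\mathcal{A}[\vartheta_2,2\pi]$. c) If $\operatorname{supp}\mu\cap\mathcal{A}(\vartheta_1,\vartheta_2)=\emptyset$, then $\mathcal{W}_n$ has at most one zero in $[\cos(\vartheta_2/2),\cos(\vartheta_1/2)]$ and, equivalently, $R_n$ has at most one zero in $\mathcal{A}[\vartheta_1,\vartheta_2]$. -/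

import Mathlib

open MeasureTheory Polynomial ComplexConjugate

namespace CDPOPUC

noncomputable section

/-- The unit circle carries its Borel σ-algebra. -/
instance instMeasurableSpaceCircle : MeasurableSpace Circle := borel Circle

instance instBorelSpaceCircle : BorelSpace Circle := ⟨rfl⟩

/-- The sesquilinear form `∫ p(ζ) conj(q(ζ)) dμ(ζ)` on polynomials. -/
def opucInner (μ : Measure Circle) (p q : ℂ[X]) : ℂ :=
  ∫ ζ : Circle, p.eval (ζ : ℂ) * conj (q.eval (ζ : ℂ)) ∂μ

/-- The monic orthogonal polynomials `Φ_n` of `μ`, obtained by applying the Gram-Schmidt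
procedure to `1, z, z², …`. -/
def monicOPUC (μ : Measure Circle) (n : ℕ) : ℂ[X] :=
  X ^ n - ∑ j : Fin n,
    C (opucInner μ (X ^ n) (monicOPUC μ j) / opucInner μ (monicOPUC μ j) (monicOPUC μ j)) *
      monicOPUC μ j
termination_by n
decreasing_by all_goals exact j.2

/-- The leading coefficient `κ_n = ‖Φ_n‖⁻¹ > 0` of the orthonormal polynomial `φ_n`,
where the norm is that of `L²(μ)`. -/
def kappa (μ : Measure Circle) (n : ℕ) : ℝ :=
  (√(∫ ζ : Circle, ‖(monicOPUC μ n).eval (ζ : ℂ)‖ ^ 2 ∂μ))⁻¹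

/-- The orthonormal polynomials `φ_n = κ_n Φ_n`. -/
def orthonormalOPUC (μ : Measure Circle) (n : ℕ) : ℂ[X] :=
  C (kappa μ n : ℂ) * monicOPUC μ n

/-- The Verblunsky coefficients `α_n = - conj (Φ_{n+1}(0))`, `n ≥ 0`. -/
def verblunsky (μ : Measure Circle) (n : ℕ) : ℂ :=
  -conj ((monicOPUC μ (n + 1)).eval 0)

/-- The reversed polynomial `Φ_n^*(z) = z^n conj (Φ_n(1 / conj z))`, i.e. if
`Φ_n(z) = ∑ a_k z^k` then `Φ_n^*(z) = ∑ conj(a_{n-k}) z^k`. -/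
def monicOPUCStar (μ : Measure Circle) (n : ℕ) : ℂ[X] :=
  ((monicOPUC μ n).map (starRingEnd ℂ)).reflect n

/-- `τ_n(w) = Φ_n(w) / Φ_n^*(w)`. -/
def tau (μ : Measure Circle) (w : Circle) (n : ℕ) : ℂ :=
  (monicOPUC μ n).eval (w : ℂ) / (monicOPUCStar μ n).eval (w : ℂ)

/-- The Christoffel-Darboux kernel `K_n(w, z) = ∑_{j=0}^n conj(φ_j(w)) φ_j(z)`, as a polynomial
in `z`. -/
def cdKernel (μ : Measure Circle) (n : ℕ) (w : Circle) : ℂ[X] :=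
  ∑ j ∈ Finset.range (n + 1),
    C (conj ((orthonormalOPUC μ j).eval (w : ℂ))) * orthonormalOPUC μ j

/-- The monic normalization `P_n(w; z)` of the Christoffel-Darboux kernel:
`P_n(w; z) = (κ_{n+1}⁻² conj(w) / conj(Φ_{n+1}(w))) * K_n(w, z) / (1 + τ_{n+1}(w) α_n)`. -/
def monicCDKernel (μ : Measure Circle) (n : ℕ) (w : Circle) : ℂ[X] :=
  C (((kappa μ (n + 1) : ℂ) ^ 2)⁻¹ * conj (w : ℂ) / conj ((monicOPUC μ (n + 1)).eval (w : ℂ)) /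
      (1 + tau μ w (n + 1) * verblunsky μ n)) *
    cdKernel μ n w

/-- The polynomials
`R_n(z) = (∏_{j=1}^n (1 - τ_{j-1} α_{j-1}) / (1 - Re (τ_{j-1} α_{j-1}))) P_n(1; z)`, where
`τ_j = τ_j(1)`. -/
def R (μ : Measure Circle) (n : ℕ) : ℂ[X] :=
  if n = 0 then 1 else
    C (∏ j ∈ Finset.range n,
        (1 - tau μ 1 j * verblunsky μ j) /
          ((1 - (tau μ 1 j * verblunsky μ j).re : ℝ) : ℂ)) *
      monicCDKernel μ n 1

/-- The functions `W_n(x) = 2^{-n} e^{-i n θ / 2} R_n(e^{i θ})` on `[-1, 1]`, where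
`x = cos (θ / 2)` and `θ ∈ [0, 2π]`, that is, `θ = 2 arccos x`. -/
def W (μ : Measure Circle) (n : ℕ) (x : ℝ) : ℂ :=
  ((2 : ℂ) ^ n)⁻¹ *
    Complex.exp (-(Complex.I * n * ((2 * Real.arccos x : ℝ) : ℂ) / 2)) *
    (R μ n).eval (Circle.exp (2 * Real.arccos x) : ℂ)

/-- The open arc `A(a, b) = {e^{iθ} : a < θ < b}`. -/
def openArc (a b : ℝ) : Set Circle := {z | ∃ θ : ℝ, a < θ ∧ θ < b ∧ z = Circle.exp θ}

/-- The closed arc `A[a, b] = {e^{iθ} : a ≤ θ ≤ b}`. -/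
def closedArc (a b : ℝ) : Set Circle := {z | ∃ θ : ℝ, a ≤ θ ∧ θ ≤ b ∧ z = Circle.exp θ}

end

end CDPOPUC

/-! For `n ≥ 1`, `R_n` is a nonzero constant multiple of `K_n(1, ·)`, because `|τ_j| = 1` and `|α_j|
< 1` keep every normalizing factor away from zero (`R_eval_eq_zero_iff`). So it suffices to locate
the zeros of the kernel.

The kernel reproduces values at `w`: `⟨p, K_n(w, ·)⟩ = p(w)` for `deg p ≤ n`. If `K_n(w, ·) = A q`
and `B(w) = 0` with `deg B ≤ deg A`, then testing against `B q` gives `∫ B conj(A) |q|² dμ = 0`.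
This is impossible when `B conj(A)` has constant phase on the infinite support
(`not_constant_phase_of_dvd_cdKernel`).

Take `w = 1`. For a zero `e^{iφ}`, choose `A = z - e^{iφ}` and `B = z - 1`; up to a constant phase,
`B conj(A)` at `e^{iθ}` is `4 sin(θ/2) sin((θ-φ)/2)`. It keeps one sign if the support misses an arc
from `1` to `e^{iφ}`, which gives a) and b). For two distinct zeros in one gap, the product of two
such expressions is nonnegative, which gives c). -/

namespace CDPOPUC

/-! ### Integrals of continuous functions and the support of the measure -/

section SupportLemmas

variable {μ : Measure Circle} [IsFiniteMeasure μ]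

lemma integrable_of_continuous {E : Type*} [NormedAddCommGroup E] {f : Circle → E}
    (hf : Continuous f) : Integrable f μ :=
  hf.integrable_of_hasCompactSupport (HasCompactSupport.of_compactSpace f)

/-- A continuous function that is nonnegative on the support of `μ` and has integral zero
vanishes on the support. -/
lemma eq_zero_on_support_of_integral_eq_zero {f : Circle → ℝ} (hf : Continuous f)
    (h0 : ∀ ζ ∈ μ.support, 0 ≤ f ζ) (hi : ∫ ζ, f ζ ∂μ = 0) : ∀ ζ ∈ μ.support, f ζ = 0 := by
  have hae : 0 ≤ᵐ[μ] f := by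
    filter_upwards [Measure.support_mem_ae (μ := μ)] with ζ hζ using h0 ζ hζ
  have hz := (integral_eq_zero_iff_of_nonneg_ae hae (integrable_of_continuous hf)).1 hi
  -- The zero set is closed and of full measure, so it contains the support: this upgrades "almost
  -- everywhere" to "everywhere".
  exact Measure.support_subset_of_isClosed (t := {ζ | f ζ = 0})
    (isClosed_eq hf continuous_const) hz

lemma continuous_eval_circle (p : ℂ[X]) : Continuous fun ζ : Circle => p.eval (ζ : ℂ) :=
  p.continuous.comp continuous_subtype_val

omit [IsFiniteMeasure μ] in
lemma eq_zero_of_eval_support_eq_zero {p : ℂ[X]} (hμ : μ.support.Infinite)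
    (h : ∀ ζ ∈ μ.support, p.eval (ζ : ℂ) = 0) : p = 0 := by
  refine p.eq_zero_of_infinite_isRoot ((hμ.image Circle.coe_injective.injOn).mono ?_)
  rintro _ ⟨ζ, hζ, rfl⟩
  exact h ζ hζ

end SupportLemmas

/-! ### The sesquilinear form on polynomials -/

section Inner

variable (μ : Measure Circle) [IsFiniteMeasure μ]

lemma integrable_opucInner (p q : ℂ[X]) :
    Integrable (fun ζ : Circle => p.eval (ζ : ℂ) * conj (q.eval (ζ : ℂ))) μ :=
  integrable_of_continuous ((continuous_eval_circle p).mul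
    (Complex.continuous_conj.comp (continuous_eval_circle q)))

lemma opucInner_add_left (p₁ p₂ q : ℂ[X]) :
    opucInner μ (p₁ + p₂) q = opucInner μ p₁ q + opucInner μ p₂ q := by
  simp only [opucInner, eval_add, add_mul]
  exact integral_add (integrable_opucInner μ p₁ q) (integrable_opucInner μ p₂ q)

omit [IsFiniteMeasure μ] in
lemma opucInner_C_mul_left (c : ℂ) (p q : ℂ[X]) :
    opucInner μ (C c * p) q = c * opucInner μ p q := by
  simp only [opucInner, eval_mul, eval_C, mul_assoc]
  exact integral_const_mul _ _

omit [IsFiniteMeasure μ] in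
lemma opucInner_conj (p q : ℂ[X]) : conj (opucInner μ p q) = opucInner μ q p := by
  rw [opucInner, ← integral_conj, opucInner]
  congr 1 with ζ
  simp [mul_comm]

omit [IsFiniteMeasure μ] in
lemma opucInner_zero_left (q : ℂ[X]) : opucInner μ 0 q = 0 := by
  simp [opucInner]

lemma opucInner_sum_left (s : Finset ℕ) (f : ℕ → ℂ[X]) (q : ℂ[X]) :
    opucInner μ (∑ i ∈ s, f i) q = ∑ i ∈ s, opucInner μ (f i) q := by
  induction s using Finset.cons_induction with
  | empty => simp [opucInner_zero_left]
  | cons a s ha ih => rw [Finset.sum_cons, Finset.sum_cons, opucInner_add_left, ih]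

lemma opucInner_add_right (p q₁ q₂ : ℂ[X]) :
    opucInner μ p (q₁ + q₂) = opucInner μ p q₁ + opucInner μ p q₂ := by
  rw [← opucInner_conj, opucInner_add_left, map_add, opucInner_conj, opucInner_conj]

omit [IsFiniteMeasure μ] in
lemma opucInner_C_mul_right (c : ℂ) (p q : ℂ[X]) :
    opucInner μ p (C c * q) = conj c * opucInner μ p q := by
  rw [← opucInner_conj, opucInner_C_mul_left, map_mul, opucInner_conj]

lemma opucInner_sum_right (s : Finset ℕ) (f : ℕ → ℂ[X]) (p : ℂ[X]) :
    opucInner μ p (∑ i ∈ s, f i) = ∑ i ∈ s, opucInner μ p (f i) := by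
  rw [← opucInner_conj, opucInner_sum_left, map_sum]
  simp only [opucInner_conj]

omit [IsFiniteMeasure μ] in
lemma opucInner_self (p : ℂ[X]) :
    opucInner μ p p = ((∫ ζ : Circle, ‖p.eval (ζ : ℂ)‖ ^ 2 ∂μ : ℝ) : ℂ) := by
  rw [opucInner, ← integral_complex_ofReal]
  congr 1 with ζ
  rw [Complex.mul_conj']
  push_cast
  rfl

omit [IsFiniteMeasure μ] in
lemma opucInner_X_mul_X_mul (p q : ℂ[X]) : opucInner μ (X * p) (X * q) = opucInner μ p q := by
  rw [opucInner, opucInner]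
  congr 1 with ζ
  have h : (ζ : ℂ) * conj (ζ : ℂ) = 1 := by simp [Complex.mul_conj]
  simp only [eval_mul, eval_X, map_mul]
  linear_combination (eval (ζ : ℂ) p * conj (eval (ζ : ℂ) q)) * h

variable {μ}

lemma integral_norm_sq_pos (hμ : μ.support.Infinite) {p : ℂ[X]} (hp : p ≠ 0) :
    0 < ∫ ζ : Circle, ‖p.eval (ζ : ℂ)‖ ^ 2 ∂μ := by
  refine lt_of_le_of_ne (integral_nonneg fun ζ => by positivity) fun h => hp ?_
  refine eq_zero_of_eval_support_eq_zero hμ fun ζ hζ => ?_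
  simpa using eq_zero_on_support_of_integral_eq_zero
    (((continuous_eval_circle p).norm).pow 2) (fun ζ _ => sq_nonneg _) h.symm ζ hζ

lemma opucInner_self_ne_zero (hμ : μ.support.Infinite) {p : ℂ[X]} (hp : p ≠ 0) :
    opucInner μ p p ≠ 0 := by
  rw [opucInner_self]
  exact_mod_cast (integral_norm_sq_pos hμ hp).ne'

end Inner

/-! ### Orthogonality, zeros in the disc, and the Christoffel–Darboux kernel -/

section OrthogonalPolynomials

variable (μ : Measure Circle)

lemma monicOPUC_eq (n : ℕ) : monicOPUC μ n = X ^ n - ∑ j ∈ Finset.range n,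
    C (opucInner μ (X ^ n) (monicOPUC μ j) / opucInner μ (monicOPUC μ j) (monicOPUC μ j)) *
      monicOPUC μ j := by
  rw [monicOPUC, ← Fin.sum_univ_eq_sum_range (fun j =>
    C (opucInner μ (X ^ n) (monicOPUC μ j) / opucInner μ (monicOPUC μ j) (monicOPUC μ j)) *
      monicOPUC μ j)]

lemma monicOPUC_degree_monic (n : ℕ) :
    (monicOPUC μ n).Monic ∧ (monicOPUC μ n).degree = n := by
  induction n using Nat.strong_induction_on with
  | _ n ih =>
    have hlt : (∑ j ∈ Finset.range n,
        C (opucInner μ (X ^ n) (monicOPUC μ j) / opucInner μ (monicOPUC μ j) (monicOPUC μ j)) *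
          monicOPUC μ j).degree < n := by
      refine (degree_sum_le _ _).trans_lt ((Finset.sup_lt_iff (WithBot.bot_lt_coe n)).2 ?_)
      intro j hj
      have hj := Finset.mem_range.1 hj
      rw [← smul_eq_C_mul]
      refine (degree_smul_le _ _).trans_lt ?_
      rw [(ih j hj).2]
      exact Nat.cast_lt.2 hj
    rw [monicOPUC_eq]
    refine ⟨monic_X_pow_sub hlt, ?_⟩
    rw [degree_sub_eq_left_of_degree_lt (by rwa [degree_X_pow]), degree_X_pow]

lemma monicOPUC_monic (n : ℕ) : (monicOPUC μ n).Monic := (monicOPUC_degree_monic μ n).1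

lemma degree_monicOPUC (n : ℕ) : (monicOPUC μ n).degree = n := (monicOPUC_degree_monic μ n).2

lemma natDegree_monicOPUC (n : ℕ) : (monicOPUC μ n).natDegree = n :=
  natDegree_eq_of_degree_eq_some (degree_monicOPUC μ n)

lemma monicOPUC_ne_zero (n : ℕ) : monicOPUC μ n ≠ 0 := (monicOPUC_monic μ n).ne_zero

lemma exists_eq_sum_monicOPUC (n : ℕ) (p : ℂ[X]) (hp : p.degree < n) :
    ∃ c : ℕ → ℂ, p = ∑ j ∈ Finset.range n, C (c j) * monicOPUC μ j := by
  induction n generalizing p with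
  | zero =>
    refine ⟨0, ?_⟩
    simpa using hp
  | succ n ih =>
    have hlt : (p - C (p.coeff n) * monicOPUC μ n).degree < n := by
      rw [degree_lt_iff_coeff_zero]
      intro m hm
      rcases hm.eq_or_lt with rfl | hm
      · have h1 : (monicOPUC μ n).coeff n = 1 := by
          simpa [Monic, leadingCoeff, natDegree_monicOPUC] using monicOPUC_monic μ n
        simp [h1]
      · have h1 : (monicOPUC μ n).coeff m = 0 :=
          coeff_eq_zero_of_natDegree_lt (by rwa [natDegree_monicOPUC])
        have h2 : p.coeff m = 0 := (degree_lt_iff_coeff_zero p (n + 1)).1 hp m hm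
        simp [h1, h2]
    obtain ⟨c, hc⟩ := ih _ hlt
    refine ⟨Function.update c n (p.coeff n), ?_⟩
    rw [Finset.sum_range_succ, Function.update_self]
    have : ∑ j ∈ Finset.range n, C (Function.update c n (p.coeff n) j) * monicOPUC μ j =
        ∑ j ∈ Finset.range n, C (c j) * monicOPUC μ j := by
      refine Finset.sum_congr rfl fun j hj => ?_
      rw [Function.update_of_ne (Finset.mem_range.1 hj).ne]
    rw [this, ← hc]
    ring

variable {μ} [IsFiniteMeasure μ] (hμ : μ.support.Infinite)
include hμ

lemma opucInner_monicOPUC_of_lt {n m : ℕ} (hmn : m < n) :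
    opucInner μ (monicOPUC μ n) (monicOPUC μ m) = 0 := by
  induction n using Nat.strong_induction_on generalizing m with
  | _ n ih =>
    have hne := opucInner_self_ne_zero hμ (monicOPUC_ne_zero μ m)
    have key : opucInner μ (∑ j ∈ Finset.range n,
        C (opucInner μ (X ^ n) (monicOPUC μ j) / opucInner μ (monicOPUC μ j) (monicOPUC μ j)) *
          monicOPUC μ j) (monicOPUC μ m) = opucInner μ (X ^ n) (monicOPUC μ m) := by
      rw [opucInner_sum_left, Finset.sum_eq_single m]
      · rw [opucInner_C_mul_left, div_mul_cancel₀ _ hne]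
      · intro j hj hjm
        rw [opucInner_C_mul_left]
        rcases hjm.lt_or_gt with h | h
        · rw [← opucInner_conj μ (monicOPUC μ m), ih m hmn h, map_zero, mul_zero]
        · rw [ih j (Finset.mem_range.1 hj) h, mul_zero]
      · intro h
        exact absurd (Finset.mem_range.2 hmn) h
    -- `Φ_n` plus its Gram–Schmidt correction is `X ^ n`, and by `key` the correction has the same
    -- product with `Φ_m` as `X ^ n` does.
    have h := opucInner_add_left μ (monicOPUC μ n) (∑ j ∈ Finset.range n,
        C (opucInner μ (X ^ n) (monicOPUC μ j) / opucInner μ (monicOPUC μ j) (monicOPUC μ j)) *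
          monicOPUC μ j) (monicOPUC μ m)
    rw [key, monicOPUC_eq μ n, sub_add_cancel, ← monicOPUC_eq] at h
    simpa using h

lemma opucInner_monicOPUC_of_ne {n m : ℕ} (hnm : n ≠ m) :
    opucInner μ (monicOPUC μ n) (monicOPUC μ m) = 0 := by
  rcases hnm.lt_or_gt with h | h
  · rw [← opucInner_conj, opucInner_monicOPUC_of_lt hμ h, map_zero]
  · exact opucInner_monicOPUC_of_lt hμ h

lemma opucInner_monicOPUC_of_degree_lt {n : ℕ} {p : ℂ[X]} (hp : p.degree < n) :
    opucInner μ p (monicOPUC μ n) = 0 := by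
  obtain ⟨c, rfl⟩ := exists_eq_sum_monicOPUC μ n p hp
  rw [opucInner_sum_left]
  refine Finset.sum_eq_zero fun j hj => ?_
  rw [opucInner_C_mul_left, opucInner_monicOPUC_of_ne hμ (Finset.mem_range.1 hj).ne, mul_zero]

/-- The zeros of the orthogonal polynomials lie in the open unit disc. -/
lemma norm_lt_one_of_isRoot_monicOPUC {n : ℕ} {z : ℂ} (hz : (monicOPUC μ n).IsRoot z) :
    ‖z‖ < 1 := by
  obtain ⟨q, hq⟩ := dvd_iff_isRoot.2 hz
  have hne : monicOPUC μ n ≠ 0 := monicOPUC_ne_zero μ n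
  have hq0 : q ≠ 0 := by rintro rfl; exact hne (by rw [hq, mul_zero])
  have hdeg : q.degree < n := by
    have h := natDegree_monicOPUC μ n
    rw [hq, natDegree_mul (X_sub_C_ne_zero z) hq0, natDegree_X_sub_C] at h
    exact (natDegree_lt_iff_degree_lt hq0).1 (by omega)
  have horth : opucInner μ q (monicOPUC μ n) = 0 := opucInner_monicOPUC_of_degree_lt hμ hdeg
  have horth' : opucInner μ (monicOPUC μ n) q = 0 := by rw [← opucInner_conj, horth, map_zero]
  -- An orthogonal decomposition. Multiplication by `X` is isometric on the circle, so Pythagoras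
  -- gives `‖q‖² = ‖Φ_n‖² + |z|² ‖q‖²`, forcing `|z| < 1`.
  have hX : X * q = monicOPUC μ n + C z * q := by rw [hq]; ring
  have h : opucInner μ q q = opucInner μ (monicOPUC μ n) (monicOPUC μ n) +
      z * conj z * opucInner μ q q := by
    have h := opucInner_X_mul_X_mul μ q q
    rw [hX, opucInner_add_left, opucInner_add_right, opucInner_add_right, opucInner_C_mul_left,
      opucInner_C_mul_left, opucInner_C_mul_right, opucInner_C_mul_right, horth, horth'] at h
    linear_combination -h
  rw [Complex.mul_conj'] at h
  simp only [opucInner_self] at h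
  have h' : ∫ ζ : Circle, ‖q.eval (ζ : ℂ)‖ ^ 2 ∂μ =
      (∫ ζ : Circle, ‖(monicOPUC μ n).eval (ζ : ℂ)‖ ^ 2 ∂μ) +
        ‖z‖ ^ 2 * ∫ ζ : Circle, ‖q.eval (ζ : ℂ)‖ ^ 2 ∂μ := by exact_mod_cast h
  have h1 := integral_norm_sq_pos hμ hq0
  have h2 := integral_norm_sq_pos hμ hne
  by_contra! h3
  nlinarith [one_le_pow₀ (n := 2) h3]

lemma eval_monicOPUC_ne_zero (n : ℕ) (w : Circle) : (monicOPUC μ n).eval (w : ℂ) ≠ 0 := by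
  intro h
  exact (norm_lt_one_of_isRoot_monicOPUC hμ h).ne (Circle.norm_coe w)

/-- Up to sign and conjugation, `α_n` is the product of the `n + 1` zeros of `Φ_{n+1}`, all in the
open disc. -/
lemma norm_verblunsky_lt_one (n : ℕ) : ‖verblunsky μ n‖ < 1 := by
  have hroots : ∀ s : Multiset ℂ, (∀ z ∈ s, ‖z‖ < 1) → s ≠ 0 → ‖s.prod‖ < 1 := by
    intro s
    induction s using Multiset.induction_on with
    | empty => simp
    | cons a s ih =>
      intro h _
      have ha : ‖a‖ < 1 := h a (Multiset.mem_cons_self a s)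
      rw [Multiset.prod_cons, norm_mul]
      rcases eq_or_ne s 0 with rfl | hs
      · simpa using ha
      · exact mul_lt_one_of_nonneg_of_lt_one_left (norm_nonneg _) ha
          (ih (fun z hz => h z (Multiset.mem_cons_of_mem hz)) hs).le
  have hsplit := IsAlgClosed.splits (monicOPUC μ (n + 1))
  rw [verblunsky, norm_neg, RCLike.norm_conj, ← coeff_zero_eq_eval_zero,
    hsplit.coeff_zero_eq_prod_roots_of_monic (monicOPUC_monic μ _), norm_mul, norm_pow, norm_neg,
    norm_one, one_pow, one_mul]
  refine hroots _ (fun z hz => norm_lt_one_of_isRoot_monicOPUC hμ (isRoot_of_mem_roots hz)) ?_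
  intro h
  have := hsplit.natDegree_eq_card_roots
  rw [natDegree_monicOPUC, h, Multiset.card_zero] at this
  omega

omit hμ [IsFiniteMeasure μ] in
lemma eval_one_monicOPUCStar (n : ℕ) :
    (monicOPUCStar μ n).eval 1 = conj ((monicOPUC μ n).eval 1) := by
  have hdeg : ((monicOPUC μ n).map (starRingEnd ℂ)).natDegree ≤ n :=
    natDegree_map_le.trans (natDegree_monicOPUC μ n).le
  let _ : Invertible (1 : ℂ) := invertibleOne
  have h := eval₂_reflect_mul_pow (RingHom.id ℂ) 1 n _ hdeg
  simp only [invOf_one, one_pow, mul_one] at h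
  rw [monicOPUCStar, eval, h, ← eval, ← Polynomial.eval_map_apply]
  simp

lemma norm_tau_one (n : ℕ) : ‖tau μ 1 n‖ = 1 := by
  have h := eval_monicOPUC_ne_zero hμ n 1
  rw [tau, Circle.coe_one, eval_one_monicOPUCStar, norm_div, RCLike.norm_conj]
  exact div_self (norm_ne_zero_iff.2 h)

lemma norm_tau_mul_verblunsky_lt_one (m n : ℕ) : ‖tau μ 1 m * verblunsky μ n‖ < 1 := by
  rw [norm_mul, norm_tau_one hμ, one_mul]
  exact norm_verblunsky_lt_one hμ n

lemma kappa_pos (n : ℕ) : 0 < kappa μ n :=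
  inv_pos.2 (Real.sqrt_pos.2 (integral_norm_sq_pos hμ (monicOPUC_ne_zero μ n)))

lemma kappa_sq_mul_opucInner (n : ℕ) :
    (kappa μ n : ℂ) ^ 2 * opucInner μ (monicOPUC μ n) (monicOPUC μ n) = 1 := by
  have h := integral_norm_sq_pos hμ (monicOPUC_ne_zero μ n)
  rw [opucInner_self, kappa]
  norm_cast
  rw [inv_pow, Real.sq_sqrt h.le, inv_mul_cancel₀ h.ne']

/-- The zeros of `R_n`, `n ≥ 1`, are those of the Christoffel-Darboux kernel. -/
lemma R_eval_eq_zero_iff {n : ℕ} (hn : n ≠ 0) (z : ℂ) :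
    (R μ n).eval z = 0 ↔ (cdKernel μ n 1).eval z = 0 := by
  have hone : ∀ v : ℂ, ‖v‖ < 1 → 1 - v ≠ 0 ∧ 1 + v ≠ 0 ∧ ((1 - v.re : ℝ) : ℂ) ≠ 0 := by
    intro v hv
    refine ⟨fun h => ?_, fun h => ?_, fun h => ?_⟩
    · rw [← sub_eq_zero.1 h, norm_one] at hv
      exact lt_irrefl _ hv
    · rw [← norm_neg, ← eq_neg_of_add_eq_zero_left h, norm_one] at hv
      exact lt_irrefl _ hv
    · have h1 := (Complex.re_le_norm v).trans_lt hv
      have h2 : 1 - v.re = 0 := by exact_mod_cast h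
      linarith
  have hprod : ∏ j ∈ Finset.range n, (1 - tau μ 1 j * verblunsky μ j) /
      ((1 - (tau μ 1 j * verblunsky μ j).re : ℝ) : ℂ) ≠ 0 :=
    Finset.prod_ne_zero_iff.2 fun j _ =>
      div_ne_zero (hone _ (norm_tau_mul_verblunsky_lt_one hμ j j)).1
        (hone _ (norm_tau_mul_verblunsky_lt_one hμ j j)).2.2
  have hk : (kappa μ (n + 1) : ℂ) ≠ 0 := by exact_mod_cast (kappa_pos hμ (n + 1)).ne'
  have hconst : ((kappa μ (n + 1) : ℂ) ^ 2)⁻¹ * conj ((1 : Circle) : ℂ) /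
      conj ((monicOPUC μ (n + 1)).eval ((1 : Circle) : ℂ)) /
        (1 + tau μ 1 (n + 1) * verblunsky μ n) ≠ 0 := by
    refine div_ne_zero (div_ne_zero (mul_ne_zero (inv_ne_zero (pow_ne_zero 2 hk)) ?_) ?_)
      (hone _ (norm_tau_mul_verblunsky_lt_one hμ (n + 1) n)).2.1
    · simp
    · simpa using eval_monicOPUC_ne_zero hμ (n + 1) 1
  rw [R, if_neg hn, monicCDKernel, eval_mul, eval_mul, eval_C, eval_C, mul_eq_zero,
    mul_eq_zero]
  simp only [hprod, hconst, false_or]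

/-- The reproducing property of the Christoffel-Darboux kernel. -/
lemma opucInner_cdKernel {n : ℕ} {p : ℂ[X]} (hp : p.natDegree ≤ n) (w : Circle) :
    opucInner μ p (cdKernel μ n w) = p.eval (w : ℂ) := by
  have hdeg : p.degree < (n + 1 : ℕ) :=
    (natDegree_le_iff_degree_le.1 hp).trans_lt (by exact_mod_cast n.lt_succ_self)
  obtain ⟨c, rfl⟩ := exists_eq_sum_monicOPUC μ (n + 1) p hdeg
  rw [opucInner_sum_left, eval_finsetSum]
  refine Finset.sum_congr rfl fun i hi => ?_
  rw [opucInner_C_mul_left, eval_mul, eval_C, cdKernel, opucInner_sum_right,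
    Finset.sum_eq_single i]
  · rw [orthonormalOPUC, opucInner_C_mul_right, opucInner_C_mul_right, eval_mul, eval_C]
    simp only [Complex.conj_conj, Complex.conj_ofReal]
    linear_combination (c i * (monicOPUC μ i).eval (w : ℂ)) * kappa_sq_mul_opucInner hμ i
  · intro j _ hj
    rw [orthonormalOPUC, opucInner_C_mul_right, opucInner_C_mul_right,
      opucInner_monicOPUC_of_ne hμ hj.symm, mul_zero, mul_zero]
  · exact fun h => absurd hi h

omit hμ [IsFiniteMeasure μ] in
lemma natDegree_cdKernel_le (n : ℕ) (w : Circle) : (cdKernel μ n w).natDegree ≤ n := by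
  refine natDegree_sum_le_of_forall_le _ _ fun j hj => ?_
  refine (natDegree_C_mul_le _ _).trans ((natDegree_C_mul_le _ _).trans ?_)
  rw [natDegree_monicOPUC]
  exact Nat.lt_succ_iff.1 (Finset.mem_range.1 hj)

/-- By reproduction, `K_n(w, w) = ‖K_n(w, ·)‖²`, and the kernel is nonzero since it reproduces the
constant `1`. -/
lemma eval_cdKernel_self_ne_zero (n : ℕ) (w : Circle) : (cdKernel μ n w).eval (w : ℂ) ≠ 0 := by
  have hne : cdKernel μ n w ≠ 0 := by
    intro h
    have h1 := opucInner_cdKernel hμ (n := n) (p := 1) (by simp) w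
    rw [h, ← opucInner_conj, opucInner_zero_left] at h1
    simp at h1
  rw [← opucInner_cdKernel hμ (natDegree_cdKernel_le n w) w]
  exact opucInner_self_ne_zero hμ hne

/-- If `A` divides the Christoffel-Darboux kernel at `w` and `B` is a nonzero polynomial of degree
at most that of `A` with `B(w) = 0`, then `B * conj A` cannot be of constant phase on the
support of `μ`. -/
lemma not_constant_phase_of_dvd_cdKernel {n : ℕ} {w : Circle} {A B : ℂ[X]}
    (hA : A ∣ cdKernel μ n w) (hB : B ≠ 0) (hBA : B.natDegree ≤ A.natDegree)
    (hBw : B.eval (w : ℂ) = 0) {u : ℂ} (hu : u ≠ 0) :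
    ¬ ∀ ζ ∈ μ.support, ∃ r : ℝ, 0 ≤ r ∧
      u * (B.eval (ζ : ℂ) * conj (A.eval (ζ : ℂ))) = r := by
  intro hpos
  obtain ⟨q, hq⟩ := hA
  have hK : cdKernel μ n w ≠ 0 := by
    intro h
    apply eval_cdKernel_self_ne_zero hμ n w
    rw [h, eval_zero]
  have hA0 : A ≠ 0 := by rintro rfl; exact hK (by rw [hq, zero_mul])
  have hq0 : q ≠ 0 := by rintro rfl; exact hK (by rw [hq, mul_zero])
  have hdeg : (B * q).natDegree ≤ n := by
    have h := natDegree_cdKernel_le (μ := μ) n w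
    rw [hq, natDegree_mul hA0 hq0] at h
    rw [natDegree_mul hB hq0]
    omega
  have hzero : opucInner μ (B * q) (A * q) = 0 := by
    rw [← hq, opucInner_cdKernel hμ hdeg, eval_mul, hBw, zero_mul]
  have hint := integrable_opucInner μ (C u * (B * q)) (A * q)
  have hre : ∫ ζ : Circle,
      ((C u * (B * q)).eval (ζ : ℂ) * conj ((A * q).eval (ζ : ℂ))).re ∂μ = 0 := by
    have h1 := integral_re hint
    simp only [RCLike.re_to_complex] at h1
    rw [h1]
    change (opucInner μ (C u * (B * q)) (A * q)).re = 0
    rw [opucInner_C_mul_left, hzero, mul_zero, Complex.zero_re]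
  have hform : ∀ ζ ∈ μ.support, ∃ r : ℝ, 0 ≤ r ∧
      u * (B.eval (ζ : ℂ) * conj (A.eval (ζ : ℂ))) = r ∧
      (C u * (B * q)).eval (ζ : ℂ) * conj ((A * q).eval (ζ : ℂ)) =
        ((r * ‖q.eval (ζ : ℂ)‖ ^ 2 : ℝ) : ℂ) := by
    intro ζ hζ
    obtain ⟨r, hr, hre⟩ := hpos ζ hζ
    refine ⟨r, hr, hre, ?_⟩
    push_cast
    rw [← Complex.mul_conj', ← hre]
    simp only [eval_mul, eval_C, map_mul]
    ring
  have hvanish := eq_zero_on_support_of_integral_eq_zero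
    (f := fun ζ : Circle => ((C u * (B * q)).eval (ζ : ℂ) * conj ((A * q).eval (ζ : ℂ))).re)
    (Complex.continuous_re.comp ((continuous_eval_circle (C u * (B * q))).mul
      (Complex.continuous_conj.comp (continuous_eval_circle (A * q)))))
    (fun ζ hζ => by
      obtain ⟨r, hr, -, h⟩ := hform ζ hζ
      rw [h, Complex.ofReal_re]
      positivity) hre
  -- A nonnegative integrand with zero integral vanishes on the support, so at each support point
  -- one of `B`, `A`, `q` is zero; their product then has infinitely many roots.
  refine mul_ne_zero (mul_ne_zero hB hA0) hq0 (eq_zero_of_eval_support_eq_zero hμ fun ζ hζ => ?_)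
  obtain ⟨r, -, hr, h⟩ := hform ζ hζ
  have h0 := hvanish ζ hζ
  rw [h, Complex.ofReal_re] at h0
  rw [eval_mul, eval_mul]
  rcases mul_eq_zero.1 h0 with h0 | h0
  · rw [h0, Complex.ofReal_zero] at hr
    rcases mul_eq_zero.1 ((mul_eq_zero.1 hr).resolve_left hu) with h1 | h1
    · rw [h1, zero_mul, zero_mul]
    · rw [(map_eq_zero _).1 h1, mul_zero, zero_mul]
  · rw [norm_eq_zero.1 (pow_eq_zero_iff two_ne_zero |>.1 h0), mul_zero]

end OrthogonalPolynomials

/-! ### Half-angle formulas on the circle -/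

section Arcs

lemma circle_exp_sub_exp (a b : ℝ) : (Circle.exp a : ℂ) - Circle.exp b =
    2 * Complex.I * Real.sin ((a - b) / 2) * Circle.exp ((a + b) / 2) := by
  have h1 : Circle.exp a = Circle.exp ((a + b) / 2) * Circle.exp ((a - b) / 2) := by
    rw [← Circle.exp_add]; congr 1; ring
  have h2 : Circle.exp b = Circle.exp ((a + b) / 2) * Circle.exp (-((a - b) / 2)) := by
    rw [← Circle.exp_add]; congr 1; ring
  rw [h1, h2]
  simp only [Circle.coe_mul, Circle.coe_exp, Complex.ofReal_sin, Complex.sin, Complex.ofReal_neg,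
    neg_mul]
  ring_nf
  rw [Complex.I_sq]
  ring

/-- Each chord is a real sine times a half-angle phase. The `θ`-dependent phases cancel, leaving
`e^{-iφ/2}`, which the prefactor removes. -/
lemma circle_exp_sub_one_mul_conj (θ φ : ℝ) :
    (Circle.exp (φ / 2) : ℂ) *
      (((Circle.exp θ : ℂ) - 1) * conj ((Circle.exp θ : ℂ) - Circle.exp φ)) =
      ((4 * Real.sin (θ / 2) * Real.sin ((θ - φ) / 2) : ℝ) : ℂ) := by
  have h1 := circle_exp_sub_exp θ 0
  rw [Circle.exp_zero, Circle.coe_one, sub_zero, add_zero] at h1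
  have h2 : Circle.exp ((θ + φ) / 2) = Circle.exp (φ / 2) * Circle.exp (θ / 2) := by
    rw [← Circle.exp_add]; congr 1; ring
  have hn : ∀ x : ℝ, (Circle.exp x : ℂ) * conj (Circle.exp x : ℂ) = 1 := fun x => by
    rw [Complex.mul_conj, Circle.normSq_coe, Complex.ofReal_one]
  rw [h1, circle_exp_sub_exp θ φ, h2]
  simp only [map_mul, Circle.coe_mul, Complex.conj_I, Complex.conj_ofReal, map_ofNat]
  simp only [Complex.ofReal_mul, Complex.ofReal_ofNat]
  have hI := Complex.I_sq
  linear_combination (4 * (Real.sin (θ / 2) : ℂ) * Real.sin ((θ - φ) / 2)) *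
    ((-Complex.I ^ 2 * Circle.exp (φ / 2) * conj (Circle.exp (φ / 2) : ℂ)) * hn (θ / 2) -
      Complex.I ^ 2 * hn (φ / 2) - hI)

lemma exists_exp_eq (ζ : Circle) : ∃ θ : ℝ, 0 ≤ θ ∧ θ < 2 * Real.pi ∧ ζ = Circle.exp θ := by
  have h := Circle.exp_arg ζ
  have h1 := Complex.neg_pi_lt_arg (ζ : ℂ)
  have h2 := Complex.arg_le_pi (ζ : ℂ)
  rcases le_or_gt 0 (Complex.arg (ζ : ℂ)) with h0 | h0
  · exact ⟨_, h0, by linarith [Real.pi_pos], h.symm⟩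
  · exact ⟨Complex.arg (ζ : ℂ) + 2 * Real.pi, by linarith, by linarith,
      by rw [Circle.exp_add_two_pi, h]⟩

lemma sin_half_nonneg {θ : ℝ} (h0 : 0 ≤ θ) (h1 : θ < 2 * Real.pi) : 0 ≤ Real.sin (θ / 2) :=
  Real.sin_nonneg_of_nonneg_of_le_pi (by linarith) (by linarith)

lemma sin_half_sub_nonneg {θ φ : ℝ} (h0 : 0 ≤ φ) (h : φ ≤ θ) (h1 : θ < 2 * Real.pi) :
    0 ≤ Real.sin ((θ - φ) / 2) :=
  Real.sin_nonneg_of_nonneg_of_le_pi (by linarith) (by linarith)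

lemma sin_half_sub_nonpos {θ φ : ℝ} (h0 : 0 ≤ θ) (h : θ ≤ φ) (h1 : φ ≤ 2 * Real.pi) :
    Real.sin ((θ - φ) / 2) ≤ 0 :=
  Real.sin_nonpos_of_nonpos_of_neg_pi_le (by linarith) (by linarith)

end Arcs

/-! ### Zeros of the kernel in gaps of the support -/

section Zeros

variable {μ : Measure Circle} [IsFiniteMeasure μ] (hμ : μ.support.Infinite)
include hμ

lemma cdKernel_one_eval_ne_zero_of_openArc_left {a : ℝ}
    (h : μ.support ∩ openArc 0 a = ∅) (n : ℕ) {φ : ℝ} (h0 : 0 ≤ φ) (hφ : φ ≤ a) :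
    (cdKernel μ n 1).eval (Circle.exp φ : ℂ) ≠ 0 := by
  intro hz
  refine not_constant_phase_of_dvd_cdKernel hμ (A := X - C (Circle.exp φ : ℂ)) (B := X - C 1)
    (dvd_iff_isRoot.2 hz) (X_sub_C_ne_zero 1) (by simp only [natDegree_X_sub_C, le_refl])
    (by simp) (Circle.coe_ne_zero (Circle.exp (φ / 2))) fun ζ hζ => ?_
  obtain ⟨θ, hθ0, hθ1, rfl⟩ := exists_exp_eq ζ
  refine ⟨4 * Real.sin (θ / 2) * Real.sin ((θ - φ) / 2), ?_, ?_⟩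
  swap
  · simpa only [eval_sub, eval_X, eval_C] using circle_exp_sub_one_mul_conj θ φ
  -- The point `1` is outside the open arc and may carry mass, but `B` vanishes there.
  rcases hθ0.eq_or_lt with rfl | hpos
  · simp
  have hθa : a ≤ θ := by
    by_contra! hlt
    exact Set.eq_empty_iff_forall_notMem.1 h _ ⟨hζ, θ, hpos, hlt, rfl⟩
  have := sin_half_nonneg hθ0 hθ1
  have := sin_half_sub_nonneg h0 (hφ.trans hθa) hθ1
  positivity

lemma cdKernel_one_eval_ne_zero_of_openArc_right {a : ℝ}
    (h : μ.support ∩ openArc a (2 * Real.pi) = ∅) (n : ℕ) {φ : ℝ} (hφ : a ≤ φ)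
    (h1 : φ ≤ 2 * Real.pi) :
    (cdKernel μ n 1).eval (Circle.exp φ : ℂ) ≠ 0 := by
  intro hz
  refine not_constant_phase_of_dvd_cdKernel hμ (A := X - C (Circle.exp φ : ℂ)) (B := X - C 1)
    (dvd_iff_isRoot.2 hz) (X_sub_C_ne_zero 1) (by simp only [natDegree_X_sub_C, le_refl])
    -- Here the support lies at angles `θ ≤ φ`, where the second sine is nonpositive; hence the
    -- minus sign in `u`.
    (by simp) (neg_ne_zero.2 (Circle.coe_ne_zero (Circle.exp (φ / 2)))) fun ζ hζ => ?_
  obtain ⟨θ, hθ0, hθ1, rfl⟩ := exists_exp_eq ζ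
  have hθa : θ ≤ a := by
    by_contra! hlt
    exact Set.eq_empty_iff_forall_notMem.1 h _ ⟨hζ, θ, hlt, hθ1, rfl⟩
  refine ⟨-(4 * Real.sin (θ / 2) * Real.sin ((θ - φ) / 2)), ?_, ?_⟩
  · have h2 := sin_half_nonneg hθ0 hθ1
    have h3 := sin_half_sub_nonpos hθ0 (hθa.trans hφ) h1
    exact neg_nonneg.2 (mul_nonpos_of_nonneg_of_nonpos (by positivity) h3)
  · rw [Complex.ofReal_neg, ← circle_exp_sub_one_mul_conj θ φ, neg_mul]
    simp

lemma cdKernel_one_zero_unique_of_openArc {a b : ℝ} (ha : 0 ≤ a) (hb : b < 2 * Real.pi)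
    (h : μ.support ∩ openArc a b = ∅) (n : ℕ) {φ ψ : ℝ} (hφ : φ ∈ Set.Icc a b)
    (hψ : ψ ∈ Set.Icc a b) (hzφ : (cdKernel μ n 1).eval (Circle.exp φ : ℂ) = 0)
    (hzψ : (cdKernel μ n 1).eval (Circle.exp ψ : ℂ) = 0) : Circle.exp φ = Circle.exp ψ := by
  by_contra hne
  have hne' : (Circle.exp φ : ℂ) - Circle.exp ψ ≠ 0 :=
    sub_ne_zero.2 fun h => hne (Circle.coe_injective h)
  have hdvd : (X - C (Circle.exp φ : ℂ)) * (X - C (Circle.exp ψ : ℂ)) ∣ cdKernel μ n 1 :=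
    (isCoprime_X_sub_C_of_isUnit_sub hne'.isUnit).mul_dvd (dvd_iff_isRoot.2 hzφ)
      (dvd_iff_isRoot.2 hzψ)
  -- The double zero of `B` at `1` matches the degree of `A` and makes `sin(θ/2)` enter squared. The
  -- other two sines agree in sign, as `φ` and `ψ` lie on the same side of every support angle.
  refine not_constant_phase_of_dvd_cdKernel hμ hdvd (B := (X - C 1) * (X - C 1))
    (mul_ne_zero (X_sub_C_ne_zero 1) (X_sub_C_ne_zero 1)) ?_ (by simp)
    (mul_ne_zero (Circle.coe_ne_zero (Circle.exp (φ / 2)))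
      (Circle.coe_ne_zero (Circle.exp (ψ / 2)))) fun ζ hζ => ?_
  · simp only [natDegree_mul (X_sub_C_ne_zero _) (X_sub_C_ne_zero _), natDegree_X_sub_C, le_refl]
  obtain ⟨θ, hθ0, hθ1, rfl⟩ := exists_exp_eq ζ
  refine ⟨(4 * Real.sin (θ / 2) * Real.sin ((θ - φ) / 2)) *
    (4 * Real.sin (θ / 2) * Real.sin ((θ - ψ) / 2)), ?_, ?_⟩
  · have h2 := sin_half_nonneg hθ0 hθ1
    have hcase : θ ≤ a ∨ b ≤ θ := by
      by_contra! hlt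
      exact Set.eq_empty_iff_forall_notMem.1 h _ ⟨hζ, θ, hlt.1, hlt.2, rfl⟩
    rcases hcase with hc | hc
    · refine mul_nonneg_of_nonpos_of_nonpos ?_ ?_
      · exact mul_nonpos_of_nonneg_of_nonpos (by positivity)
          (sin_half_sub_nonpos hθ0 (hc.trans hφ.1) (hφ.2.trans hb.le))
      · exact mul_nonpos_of_nonneg_of_nonpos (by positivity)
          (sin_half_sub_nonpos hθ0 (hc.trans hψ.1) (hψ.2.trans hb.le))
    · have := sin_half_sub_nonneg (ha.trans hφ.1) (hφ.2.trans hc) hθ1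
      have := sin_half_sub_nonneg (ha.trans hψ.1) (hψ.2.trans hc) hθ1
      positivity
  · rw [Complex.ofReal_mul, ← circle_exp_sub_one_mul_conj θ φ, ← circle_exp_sub_one_mul_conj θ ψ]
    simp only [eval_mul, eval_sub, eval_X, eval_C, map_mul]
    ring

omit [IsFiniteMeasure μ] hμ in
lemma R_zero_eval (z : ℂ) : (R μ 0).eval z = 1 := by
  simp [R]

omit [IsFiniteMeasure μ] hμ in
lemma W_eq_zero_iff (n : ℕ) (x : ℝ) :
    W μ n x = 0 ↔ (R μ n).eval (Circle.exp (2 * Real.arccos x) : ℂ) = 0 := by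
  simp [W, Complex.exp_ne_zero]

end Zeros

lemma two_mul_arccos_mem_Icc {a b x : ℝ} (ha : 0 ≤ a) (hb : b ≤ 2 * Real.pi)
    (hab : a ≤ 2 * Real.pi) (hb0 : 0 ≤ b)
    (hx : x ∈ Set.Icc (Real.cos (b / 2)) (Real.cos (a / 2))) :
    2 * Real.arccos x ∈ Set.Icc a b := by
  have h1 := Real.arccos_le_arccos hx.1
  have h2 := Real.arccos_le_arccos hx.2
  rw [Real.arccos_cos (by linarith) (by linarith)] at h1 h2
  constructor <;> linarith

end CDPOPUC

theorem mainTheorem9 (μ : Measure Circle) [IsFiniteMeasure μ] (hμ : μ.support.Infinite)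
    (ϑ₁ ϑ₂ : ℝ) (h₁ : 0 < ϑ₁) (h₁₂ : ϑ₁ < ϑ₂) (h₂ : ϑ₂ < 2 * Real.pi) (n : ℕ) :
    (μ.support ∩ CDPOPUC.openArc 0 ϑ₁ = ∅ →
      (∀ x ∈ Set.Icc (Real.cos (ϑ₁ / 2)) 1, CDPOPUC.W μ n x ≠ 0) ∧
      (∀ z ∈ CDPOPUC.closedArc 0 ϑ₁, (CDPOPUC.R μ n).eval (z : ℂ) ≠ 0)) ∧
    (μ.support ∩ CDPOPUC.openArc ϑ₂ (2 * Real.pi) = ∅ →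
      (∀ x ∈ Set.Icc (-1) (Real.cos (ϑ₂ / 2)), CDPOPUC.W μ n x ≠ 0) ∧
      (∀ z ∈ CDPOPUC.closedArc ϑ₂ (2 * Real.pi), (CDPOPUC.R μ n).eval (z : ℂ) ≠ 0)) ∧
    (μ.support ∩ CDPOPUC.openArc ϑ₁ ϑ₂ = ∅ →
      {x ∈ Set.Icc (Real.cos (ϑ₂ / 2)) (Real.cos (ϑ₁ / 2)) | CDPOPUC.W μ n x = 0}.Subsingleton ∧
      {z ∈ CDPOPUC.closedArc ϑ₁ ϑ₂ | (CDPOPUC.R μ n).eval (z : ℂ) = 0}.Subsingleton) := by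
  -- `R_0 = 1` is set by definition rather than through the kernel.
  rcases eq_or_ne n 0 with rfl | hn
  · simp [CDPOPUC.W_eq_zero_iff, CDPOPUC.R_zero_eval]
  simp only [ne_eq, CDPOPUC.W_eq_zero_iff, CDPOPUC.R_eval_eq_zero_iff hμ hn]
  refine ⟨fun h => ?_, fun h => ?_, fun h => ?_⟩
  · have key : ∀ φ : ℝ, φ ∈ Set.Icc 0 ϑ₁ →
        ¬ (CDPOPUC.cdKernel μ n 1).eval (Circle.exp φ : ℂ) = 0 := fun φ hφ =>
      CDPOPUC.cdKernel_one_eval_ne_zero_of_openArc_left hμ h n hφ.1 hφ.2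
    refine ⟨fun x hx => key _ ?_, ?_⟩
    · exact CDPOPUC.two_mul_arccos_mem_Icc le_rfl (by linarith) (by linarith) h₁.le
        (by simpa using hx)
    · rintro _ ⟨φ, hφ0, hφ1, rfl⟩
      exact key φ ⟨hφ0, hφ1⟩
  · have key : ∀ φ : ℝ, φ ∈ Set.Icc ϑ₂ (2 * Real.pi) →
        ¬ (CDPOPUC.cdKernel μ n 1).eval (Circle.exp φ : ℂ) = 0 := fun φ hφ =>
      CDPOPUC.cdKernel_one_eval_ne_zero_of_openArc_right hμ h n hφ.1 hφ.2
    refine ⟨fun x hx => key _ ?_, ?_⟩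
    · exact CDPOPUC.two_mul_arccos_mem_Icc (by linarith) le_rfl h₂.le (by linarith)
        (by simpa using hx)
    · rintro _ ⟨φ, hφ0, hφ1, rfl⟩
      exact key φ ⟨hφ0, hφ1⟩
  · have key {φ ψ : ℝ} (hφ : φ ∈ Set.Icc ϑ₁ ϑ₂) (hψ : ψ ∈ Set.Icc ϑ₁ ϑ₂) :=
      CDPOPUC.cdKernel_one_zero_unique_of_openArc hμ h₁.le h₂ h n hφ hψ
    refine ⟨?_, ?_⟩
    · rintro x ⟨hx, hx0⟩ y ⟨hy, hy0⟩
      have hx' := CDPOPUC.two_mul_arccos_mem_Icc h₁.le h₂.le (by linarith) (by linarith) hx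
      have hy' := CDPOPUC.two_mul_arccos_mem_Icc h₁.le h₂.le (by linarith) (by linarith) hy
      -- The angles lie in an interval shorter than `2π`, so equal points on the circle have equal
      -- angles.
      have hxy := Circle.exp_injOn_Icc (by linarith) hx' hy' (key hx' hy' hx0 hy0)
      refine Real.arccos_injOn ?_ ?_ (mul_left_cancel₀ two_ne_zero hxy)
      · exact ⟨(Real.neg_one_le_cos _).trans hx.1, hx.2.trans (Real.cos_le_one _)⟩
      · exact ⟨(Real.neg_one_le_cos _).trans hy.1, hy.2.trans (Real.cos_le_one _)⟩
    · rintro _ ⟨⟨φ, hφ0, hφ1, rfl⟩, hz⟩ _ ⟨⟨ψ, hψ0, hψ1, rfl⟩, hw⟩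
      exact key ⟨hφ0, hφ1⟩ ⟨hψ0, hψ1⟩ hz hw
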